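/- Let $\Omega_1\subset\Omega\subset\mathbb{R}^3$ be open sets (for instance domains), and for $t\in\mathbb{R}$ let $\Omega_t=\{(y,z)\in\mathbb{R}^2:(t,y,z)\in\Omega\}$. For a scalar function $f$ on $\Omega$ let $$|D_{y,z}f|(\Omega_t)=\sup\Big\{\int_{\Omega_t} f(t,y,z)\,\mathrm{div}\,\varphi(y,z)\,dy\,dz:\ \varphi\in C^1_c(\Omega_t;\mathbb{R}^2),\ |\varphi|\le 1\Big\}$$ if $f(t,\cdot)\in L^1_{\mathrm{loc}}(\Omega_t)$, and $|D_{y,z}f|(\Omega_t)=\infty$ otherwise. The slice-wise curl of $f$ is $\|\mathrm{curl} f\|(\Omega)=\int_{\mathbb{R}}|D_{y,z}f|(\Omega_t)\,dt\in[0,\infty]$. Let $p\in[1,\infty)$, let $f$ and $g$ be real-valued functions on $\Omega$ with $f$ measurable, and suppose that $f=0$ on $\Omega\setminus\Omega_1$, $gf\in L^p(\Omega_1)$ and $\|\mathrm{curl} f\|(\Omega)<\infty$. For $n\in\mathbb{N}$ let $f^n=\max(-n,\min(f,n))$ be the truncation of $f$ at the levels $\pm n$. Then $f^n\in L^\infty(\Omega)$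 with $|f^n|\le n$, $f^n=0$ on $\Omega\setminus\Omega_1$, $gf$ and all $gf^n$ belong to $L^p(\Omega)$, and $gf^n\to gf$ in $L^p(\Omega)$ as $n\to\infty$. Moreover, for every $n$, $|D_{y,z}f^n|(\Omega_t)\le|D_{y,z}f|(\Omega_t)$ for every $t\in\mathbb{R}$, and consequently $\|\mathrm{curl} f^n\|(\Omega)\le\|\mathrm{curl} f\|(\Omega)$. -/

import Mathlib

open MeasureTheory Filter Topology
open scoped ENNReal

noncomputable section

/-- The divergence `∑ᵢ ∂ᵢ φᵢ` of a planar vector field. -/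
def planarDiv (φ : EuclideanSpace ℝ (Fin 2) → EuclideanSpace ℝ (Fin 2))
    (y : EuclideanSpace ℝ (Fin 2)) : ℝ :=
  ∑ i : Fin 2, (fderiv ℝ φ y (EuclideanSpace.single i 1)) i

/-- The admissible test fields on a planar set `U`: vector fields of class `C¹`, compactly
supported in `U`, with Euclidean norm at most one everywhere. -/
def planarTestFields (U : Set (EuclideanSpace ℝ (Fin 2))) :
    Set (EuclideanSpace ℝ (Fin 2) → EuclideanSpace ℝ (Fin 2)) :=
  {φ | ContDiff ℝ 1 φ ∧ HasCompactSupport φ ∧ tsupport φ ⊆ U ∧ ∀ y, ‖φ y‖ ≤ 1}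

open Classical in
/-- The total variation `|Du|(U)` of a scalar function `u` on a planar open set `U`:
the supremum of `∫_U u div φ` over all admissible test fields `φ` if `u` is locally integrable
on `U`, and `∞` otherwise. (Replacing `φ` by `-φ` shows that cutting off negative values of the
integrals does not change the supremum.) -/
def planarTotalVariation (U : Set (EuclideanSpace ℝ (Fin 2)))
    (u : EuclideanSpace ℝ (Fin 2) → ℝ) : ℝ≥0∞ :=
  if LocallyIntegrableOn u U volume then
    ⨆ φ ∈ planarTestFields U, ENNReal.ofReal (∫ y in U, u y * planarDiv φ y)
  else ∞

/-- The point `(t, y, z)` of space, for `(y, z)` in the plane. -/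
def slicePoint (t : ℝ) (y : EuclideanSpace ℝ (Fin 2)) : EuclideanSpace ℝ (Fin 3) :=
  !₂[t, y 0, y 1]

/-- The planar curl density `|curl f|(Ω ∩ {x¹ = t}) = |D_{y,z} f|(Ω ∩ {x¹ = t})`: the total
variation of `f` on the slice of `Ω` at height `t`. -/
def curlDensity (Ω : Set (EuclideanSpace ℝ (Fin 3))) (f : EuclideanSpace ℝ (Fin 3) → ℝ)
    (t : ℝ) : ℝ≥0∞ :=
  planarTotalVariation (slicePoint t ⁻¹' Ω) (fun y => f (slicePoint t y))

/-- The slice-wise curl `‖curl f‖(Ω) = ∫ |curl f|(Ω ∩ {x¹ = t}) dt`. -/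
def curlNorm (Ω : Set (EuclideanSpace ℝ (Fin 3))) (f : EuclideanSpace ℝ (Fin 3) → ℝ) : ℝ≥0∞ :=
  ∫⁻ t : ℝ, curlDensity Ω f t

/-- The truncation of `f` at the levels `±n`. -/
def truncLevel (n : ℕ) (f : EuclideanSpace ℝ (Fin 3) → ℝ) : EuclideanSpace ℝ (Fin 3) → ℝ :=
  fun x => max (-(n : ℝ)) (min (f x) (n : ℝ))

end

/-! On a single slice the claim is that clipping does not increase total variation. For `v` of class
`C¹` and smooth `S` with `|S'| ≤ 1`, integrating by parts twice gives `∫ S(v) div φ = ∫ v div (S'(v)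
φ)`, and `S'(v) φ` is again admissible (`integral_comp_mul_planarDiv`). A locally integrable `u` is
replaced by mollifications. These are averages of translates of `u`, so on test fields supported
well inside `U` they obey the variation bound of `u` (`integral_convolution_mul_planarDiv_le`).
Dominated convergence removes first the mollification, then the smoothing of the clip.

The curl bound is this estimate on every slice, integrated in `t`. The `Lᵖ` convergence is dominated
convergence: at each point the truncations eventually equal `f`, and the error is at most `|g f|`.
-/

theorem planarDiv_eq_sum {φ : EuclideanSpace ℝ (Fin 2) → EuclideanSpace ℝ (Fin 2)}
    {y : EuclideanSpace ℝ (Fin 2)} (hφ : DifferentiableAt ℝ φ y) :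
    planarDiv φ y =
      ∑ i : Fin 2, fderiv ℝ (fun z => φ z i) y (EuclideanSpace.single i 1) := by
  refine Finset.sum_congr rfl fun i _ => ?_
  have h := ((EuclideanSpace.proj i : EuclideanSpace ℝ (Fin 2) →L[ℝ] ℝ).hasFDerivAt.comp y
    hφ.hasFDerivAt).fderiv
  change _ = (fderiv ℝ ((EuclideanSpace.proj i : EuclideanSpace ℝ (Fin 2) →L[ℝ] ℝ) ∘ φ) y) _
  rw [h]
  rfl

theorem continuous_planarDiv {φ : EuclideanSpace ℝ (Fin 2) → EuclideanSpace ℝ (Fin 2)}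
    (hφ : ContDiff ℝ 1 φ) : Continuous (planarDiv φ) := by
  have h := hφ.continuous_fderiv one_ne_zero
  unfold planarDiv
  fun_prop

theorem planarDiv_eq_zero_of_notMem_tsupport
    {φ : EuclideanSpace ℝ (Fin 2) → EuclideanSpace ℝ (Fin 2)} {y : EuclideanSpace ℝ (Fin 2)}
    (hy : y ∉ tsupport φ) : planarDiv φ y = 0 := by
  have h : fderiv ℝ φ y = 0 := by
    by_contra h
    exact hy (support_fderiv_subset ℝ h)
  simp [planarDiv, h]

theorem hasCompactSupport_planarDiv
    {φ : EuclideanSpace ℝ (Fin 2) → EuclideanSpace ℝ (Fin 2)} (hφ : HasCompactSupport φ) :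
    HasCompactSupport (planarDiv φ) :=
  HasCompactSupport.intro hφ fun _ => planarDiv_eq_zero_of_notMem_tsupport

theorem planarDiv_comp_add_right (φ : EuclideanSpace ℝ (Fin 2) → EuclideanSpace ℝ (Fin 2))
    (y w : EuclideanSpace ℝ (Fin 2)) :
    planarDiv (fun z => φ (z + w)) y = planarDiv φ (y + w) := by
  simp [planarDiv, fderiv_comp_add_right]

/-- Integration by parts against a compactly supported planar vector field. -/
theorem integral_mul_planarDiv_eq_neg {a : EuclideanSpace ℝ (Fin 2) → ℝ}
    {φ : EuclideanSpace ℝ (Fin 2) → EuclideanSpace ℝ (Fin 2)}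
    (ha : ContDiff ℝ 1 a) (hφ : ContDiff ℝ 1 φ) (hc : HasCompactSupport φ) :
    ∫ y, a y * planarDiv φ y =
      -∑ i : Fin 2, ∫ y, fderiv ℝ a y (EuclideanSpace.single i 1) * φ y i := by
  have hφi : ∀ i : Fin 2, ContDiff ℝ 1 (fun y => φ y i) := fun i => by fun_prop
  have hci : ∀ i : Fin 2, HasCompactSupport (fun y => φ y i) := fun i =>
    hc.comp_left (g := fun x : EuclideanSpace ℝ (Fin 2) => x i) rfl
  have hac := ha.continuous_fderiv one_ne_zero
  have hφc := fun i => (hφi i).continuous_fderiv one_ne_zero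
  have hcf : ∀ i : Fin 2, HasCompactSupport
      (fun y => fderiv ℝ (fun z => φ z i) y (EuclideanSpace.single i 1)) := fun i =>
    (hci i).fderiv_apply (𝕜 := ℝ) _
  have hint : ∀ i : Fin 2, Integrable
      (fun y => a y * fderiv ℝ (fun z => φ z i) y (EuclideanSpace.single i 1)) := fun i => by
    refine Continuous.integrable_of_hasCompactSupport ?_ (hcf i).mul_left
    have := ha.continuous
    have := hφc i
    fun_prop
  simp_rw [planarDiv_eq_sum (hφ.differentiable one_ne_zero _), Finset.mul_sum]
  rw [integral_finsetSum _ fun i _ => hint i, ← Finset.sum_neg_distrib]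
  refine Finset.sum_congr rfl fun i _ => ?_
  refine integral_mul_fderiv_eq_neg_fderiv_mul_of_integrable ?_ (hint i) ?_
    (fun y _ => ha.differentiable one_ne_zero y)
    (fun y _ => (hφi i).differentiable one_ne_zero y)
  · refine Continuous.integrable_of_hasCompactSupport ?_ (hci i).mul_left
    fun_prop
  · refine Continuous.integrable_of_hasCompactSupport ?_ (hci i).mul_left
    have := ha.continuous
    fun_prop

/-- By the chain rule both sides equal `-∫ s(v) ∇v · φ`. The nonlinearity thus moves from the
function to the test field. -/
theorem integral_comp_mul_planarDiv {S s : ℝ → ℝ} (hS : ∀ r, HasDerivAt S (s r) r)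
    (hs : ContDiff ℝ 1 s) {v : EuclideanSpace ℝ (Fin 2) → ℝ} (hv : ContDiff ℝ 1 v)
    {φ : EuclideanSpace ℝ (Fin 2) → EuclideanSpace ℝ (Fin 2)}
    (hφ : ContDiff ℝ 1 φ) (hc : HasCompactSupport φ) :
    ∫ y, S (v y) * planarDiv φ y = ∫ y, v y * planarDiv (fun z => s (v z) • φ z) y := by
  have hSc : ContDiff ℝ 1 S := by
    rw [contDiff_one_iff_deriv, funext fun r => (hS r).deriv]
    exact ⟨fun r => (hS r).differentiableAt, hs.continuous⟩
  have hψ : ContDiff ℝ 1 (fun z => s (v z) • φ z) := (hs.comp hv).smul hφ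
  have hψc : HasCompactSupport (fun z => s (v z) • φ z) :=
    hc.smul_left (f := fun z => s (v z))
  rw [integral_mul_planarDiv_eq_neg (a := fun y => S (v y)) (hSc.comp hv) hφ hc,
    integral_mul_planarDiv_eq_neg hv hψ hψc]
  congr 1
  refine Finset.sum_congr rfl fun i _ => integral_congr_ae (Eventually.of_forall fun y => ?_)
  have h : fderiv ℝ (fun y => S (v y)) y = s (v y) • fderiv ℝ v y :=
    ((hS (v y)).comp_hasFDerivAt y (hv.differentiable one_ne_zero y).hasFDerivAt).fderiv
  simp only [h, smul_apply, smul_eq_mul, PiLp.smul_apply]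
  ring

/-! ### Total variation under mollification and smooth contractions -/

/-- On test fields supported well inside `U`, the mollification of a locally integrable function
satisfies the bound by the total variation. -/
theorem integral_convolution_mul_planarDiv_le {U K : Set (EuclideanSpace ℝ (Fin 2))}
    {u : EuclideanSpace ℝ (Fin 2) → ℝ} (hu : LocallyIntegrableOn u U volume)
    (hV : planarTotalVariation U u ≠ ∞) (hK : IsCompact K) {δ : ℝ}
    (hKU : Metric.cthickening δ K ⊆ U)
    {ψ : EuclideanSpace ℝ (Fin 2) → EuclideanSpace ℝ (Fin 2)} (hψ : ContDiff ℝ 1 ψ)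
    (hψK : tsupport ψ ⊆ K) (hψ1 : ∀ y, ‖ψ y‖ ≤ 1)
    (ρ : ContDiffBump (0 : EuclideanSpace ℝ (Fin 2))) (hρ : ρ.rOut ≤ δ) :
    ∫ y, (convolution (ρ.normed volume) ((Metric.cthickening δ K).indicator u)
      (ContinuousLinearMap.lsmul ℝ ℝ) volume) y * planarDiv ψ y ≤
      (planarTotalVariation U u).toReal := by
  set V := (planarTotalVariation U u).toReal with hVdef
  set w := (Metric.cthickening δ K).indicator u with hw
  have hKc : IsCompact (Metric.cthickening δ K) := hK.cthickening
  have hψc : HasCompactSupport ψ := hK.of_isClosed_subset (isClosed_tsupport ψ) hψK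
  have hwint : Integrable w := by
    rw [hw, integrable_indicator_iff hKc.isClosed.measurableSet]
    exact hu.integrableOn_compact_subset hKU hKc
  have hDcont := continuous_planarDiv hψ
  have hDcs := hasCompactSupport_planarDiv hψc
  obtain ⟨C, hC⟩ := hDcs.exists_bound_of_continuous hDcont
  have hprod : Integrable (fun p : EuclideanSpace ℝ (Fin 2) × EuclideanSpace ℝ (Fin 2) =>
      (ρ.normed volume p.2 * w (p.1 - p.2)) * planarDiv ψ p.1) (volume.prod volume) := by
    refine Integrable.mul_bdd (c := C) (Integrable.convolution_integrand
      (ContinuousLinearMap.lsmul ℝ ℝ) (ρ.integrable_normed (μ := volume)) hwint)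
      (by fun_prop) (Eventually.of_forall fun p => hC p.1)
  -- Shifting `w` by `t` amounts to shifting `ψ` by `-t`. The shifted field lives in the
  -- `δ`-thickening of `K`, so it is admissible on `U`, and there `w = u`.
  have htrans : ∀ t, ‖t‖ ≤ δ → ∫ y, w (y - t) * planarDiv ψ y ≤ V := by
    intro t ht
    have hts : tsupport (fun z => ψ (z + t)) ⊆ Metric.cthickening δ K := by
      intro z hz
      have hz' : z + t ∈ tsupport ψ := by
        have := tsupport_comp_eq_preimage ψ (Homeomorph.addRight t)
        exact (Set.ext_iff.mp this z).mp hz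
      refine Metric.mem_cthickening_of_dist_le z (z + t) δ K (hψK hz') ?_
      simpa [dist_eq_norm] using ht
    have hmem : (fun z => ψ (z + t)) ∈ planarTestFields U := by
      refine ⟨by fun_prop, hKc.of_isClosed_subset (isClosed_tsupport _) hts, hts.trans hKU,
        fun y => hψ1 _⟩
    have h1 : ∫ y, w (y - t) * planarDiv ψ y =
        ∫ y in U, u y * planarDiv (fun z => ψ (z + t)) y := by
      rw [setIntegral_eq_integral_of_forall_compl_eq_zero fun y hy => by
        rw [planarDiv_eq_zero_of_notMem_tsupport fun h => hy (hKU (hts h)), mul_zero]]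
      rw [← integral_add_right_eq_self _ t]
      refine integral_congr_ae (Eventually.of_forall fun y => ?_)
      simp only [add_sub_cancel_right, planarDiv_comp_add_right]
      by_cases hy : y ∈ Metric.cthickening δ K
      · rw [hw, Set.indicator_of_mem hy]
      · rw [← planarDiv_comp_add_right,
          planarDiv_eq_zero_of_notMem_tsupport fun h => hy (hts h), mul_zero, mul_zero]
    rw [h1, hVdef, ← ENNReal.ofReal_le_iff_le_toReal hV, planarTotalVariation, if_pos hu]
    exact le_iSup₂ (f := fun φ (_ : φ ∈ planarTestFields U) =>
      ENNReal.ofReal (∫ y in U, u y * planarDiv φ y)) _ hmem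
  calc ∫ y, (convolution (ρ.normed volume) w (ContinuousLinearMap.lsmul ℝ ℝ) volume) y *
        planarDiv ψ y
      = ∫ y, ∫ t, (ρ.normed volume t * w (y - t)) * planarDiv ψ y := by
        simp_rw [integral_mul_const]
        rfl
    _ = ∫ t, ∫ y, (ρ.normed volume t * w (y - t)) * planarDiv ψ y :=
        integral_integral_swap hprod
    _ ≤ ∫ t, ρ.normed volume t * V := by
        refine integral_mono hprod.integral_prod_right
          ((ρ.integrable_normed (μ := volume)).mul_const V) fun t => ?_
        simp only [mul_assoc, integral_const_mul]
        by_cases ht : ‖t‖ ≤ δ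
        · exact mul_le_mul_of_nonneg_left (htrans t ht) (ρ.nonneg_normed t)
        · have : ρ.normed volume t = 0 := by
            rw [← Function.notMem_support, ρ.support_normed_eq]
            intro h
            exact ht ((mem_ball_zero_iff.mp h).le.trans hρ)
          simp [this]
    _ = V := by rw [integral_mul_const, ρ.integral_normed, one_mul]

/-- The total variation bound survives composition with a bounded `C²` contraction. -/
theorem ofReal_integral_comp_mul_planarDiv_le {U : Set (EuclideanSpace ℝ (Fin 2))}
    (hU : IsOpen U) {u : EuclideanSpace ℝ (Fin 2) → ℝ} (hu : LocallyIntegrableOn u U volume)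
    {S s : ℝ → ℝ} (hS : ∀ r, HasDerivAt S (s r) r) (hs : ContDiff ℝ 1 s)
    (hs1 : ∀ r, |s r| ≤ 1) {M : ℝ} (hSM : ∀ r, |S r| ≤ M)
    {φ : EuclideanSpace ℝ (Fin 2) → EuclideanSpace ℝ (Fin 2)} (hφ : φ ∈ planarTestFields U) :
    ENNReal.ofReal (∫ y in U, S (u y) * planarDiv φ y) ≤ planarTotalVariation U u := by
  by_cases hV : planarTotalVariation U u = ∞
  · simp [hV]
  rw [ENNReal.ofReal_le_iff_le_toReal hV]
  obtain ⟨hφd, hφc, hφU, hφ1⟩ := hφ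
  have hScont : Continuous S := continuous_iff_continuousAt.2 fun r => (hS r).continuousAt
  obtain ⟨δ, hδ, hKU⟩ := IsCompact.exists_cthickening_subset_open hφc hU hφU
  set K := tsupport φ with hK
  -- Cutting `u` off on a compact neighbourhood of the support of `φ` makes it globally integrable,
  -- hence ready for convolution.
  set w := (Metric.cthickening δ K).indicator u with hw
  have hKc : IsCompact (Metric.cthickening δ K) := IsCompact.cthickening hφc
  have hwint : Integrable w := by
    rw [hw, integrable_indicator_iff hKc.isClosed.measurableSet]
    exact hu.integrableOn_compact_subset hKU hKc
  have hDcont := continuous_planarDiv hφd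
  have hDcs := hasCompactSupport_planarDiv hφc
  have hDint := hDcont.integrable_of_hasCompactSupport hDcs (μ := volume)
  let ρ : ℕ → ContDiffBump (0 : EuclideanSpace ℝ (Fin 2)) := fun k =>
    { rIn := δ / (k + 1) / 2
      rOut := δ / (k + 1)
      rIn_pos := by positivity
      rIn_lt_rOut := half_lt_self (by positivity) }
  have hρ0 : Tendsto (fun k => (ρ k).rOut) atTop (𝓝 0) :=
    tendsto_const_nhds.div_atTop
      (tendsto_natCast_atTop_atTop.atTop_add tendsto_const_nhds)
  have hρδ : ∀ k, (ρ k).rOut ≤ δ := fun k =>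
    div_le_self hδ.le (by linarith [Nat.cast_nonneg (α := ℝ) k])
  let v : ℕ → EuclideanSpace ℝ (Fin 2) → ℝ := fun k =>
    convolution ((ρ k).normed volume) w (ContinuousLinearMap.lsmul ℝ ℝ) volume
  have hv : ∀ k, ContDiff ℝ 1 (v k) := fun k =>
    (ρ k).hasCompactSupport_normed.contDiff_convolution_left _ (ρ k).contDiff_normed
      hwint.locallyIntegrable
  have hlim : ∀ᵐ y, Tendsto (fun k => v k y) atTop (𝓝 (w y)) :=
    -- The ratio of outer to inner radius is exactly 2, so the bumps shrink with bounded shape and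
    -- Lebesgue differentiation applies.
    ContDiffBump.ae_convolution_tendsto_right_of_locallyIntegrable (K := 2) hρ0
      (Eventually.of_forall fun k => by
        change (ρ k).rOut ≤ 2 * ((ρ k).rOut / 2)
        linarith) hwint.locallyIntegrable
  have hbound : ∀ k, ∫ y, S (v k y) * planarDiv φ y ≤ (planarTotalVariation U u).toReal := by
    intro k
    rw [integral_comp_mul_planarDiv hS hs (hv k) hφd hφc]
    have hψ : ContDiff ℝ 1 (fun z => s (v k z) • φ z) := (hs.comp (hv k)).smul hφd
    have hψK : tsupport (fun z => s (v k z) • φ z) ⊆ K :=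
      tsupport_smul_subset_right (fun z => s (v k z)) φ
    refine integral_convolution_mul_planarDiv_le hu hV hφc hKU hψ hψK (fun y => ?_) (ρ k) (hρδ k)
    rw [norm_smul]
    exact mul_le_one₀ (hs1 _) (norm_nonneg _) (hφ1 y)
  have hconv : Tendsto (fun k => ∫ y, S (v k y) * planarDiv φ y) atTop
      (𝓝 (∫ y, S (w y) * planarDiv φ y)) := by
    refine tendsto_integral_of_dominated_convergence (fun y => M * ‖planarDiv φ y‖)
      (fun k => ?_) (hDint.norm.const_mul M) (fun k => Eventually.of_forall fun y => ?_) ?_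
    · exact ((hScont.comp (hv k).continuous).mul hDcont).aestronglyMeasurable
    · rw [norm_mul]
      exact mul_le_mul_of_nonneg_right (hSM _) (norm_nonneg _)
    · filter_upwards [hlim] with y hy
      exact ((hScont.tendsto _).comp hy).mul_const _
  have heq : ∫ y in U, S (u y) * planarDiv φ y = ∫ y, S (w y) * planarDiv φ y := by
    rw [setIntegral_eq_integral_of_forall_compl_eq_zero fun y hy => by
      rw [planarDiv_eq_zero_of_notMem_tsupport fun h => hy (hφU h), mul_zero]]
    refine integral_congr_ae (Eventually.of_forall fun y => ?_)
    by_cases hy : y ∈ K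
    · simp only [hw, Set.indicator_of_mem (Metric.self_subset_cthickening K hy)]
    · simp only [planarDiv_eq_zero_of_notMem_tsupport hy, mul_zero]
  rw [heq]
  exact le_of_tendsto' hconv hbound

/-! ### Total variation under clipping -/

/-- A smooth monotone contraction uniformly close to the truncation at levels `±c`. -/
theorem exists_smooth_approx_clip {c δ : ℝ} (hc : 0 ≤ c) (hδ : 0 < δ) :
    ∃ S s : ℝ → ℝ, (∀ r, HasDerivAt S (s r) r) ∧ ContDiff ℝ 1 s ∧ (∀ r, |s r| ≤ 1) ∧
      ∀ r, |S r - max (-c) (min r c)| ≤ δ := by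
  -- `b` is the derivative of `S`: it is 1 on `[-c, c]`, so `S` is the identity there, and 0 beyond
  -- `c + δ`, so `S` overshoots `±c` by at most `δ`.
  let b : ContDiffBump (0 : ℝ) :=
    { rIn := c + δ / 2
      rOut := c + δ
      rIn_pos := by positivity
      rIn_lt_rOut := by linarith }
  have hbi : ∀ x y, IntervalIntegrable b volume x y := fun x y =>
    b.continuous.intervalIntegrable x y
  let S : ℝ → ℝ := fun r => ∫ x in (0 : ℝ)..r, b x
  have hdiff : ∀ x y, S y - S x = ∫ z in x..y, b z := fun x y =>
    intervalIntegral.integral_interval_sub_left (hbi _ _) (hbi _ _)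
  have hmono : Monotone S := fun x y hxy => by
    rw [← sub_nonneg, hdiff]
    exact intervalIntegral.integral_nonneg hxy fun z _ => b.nonneg
  have hS_id : ∀ r, |r| ≤ c → S r = r := by
    intro r hr
    have : ∫ x in (0 : ℝ)..r, b x = ∫ x in (0 : ℝ)..r, (1 : ℝ) := by
      refine intervalIntegral.integral_congr fun x hx => b.one_of_mem_closedBall ?_
      have h1 : |x - 0| ≤ |r - 0| := Set.abs_sub_left_of_mem_uIcc hx
      rw [mem_closedBall_zero_iff, Real.norm_eq_abs]
      change |x| ≤ c + δ / 2
      simp only [sub_zero] at h1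
      linarith
    simpa [S] using this
  have hcontr : ∀ x y, x ≤ y → S y - S x ≤ y - x := by
    intro x y hxy
    have := intervalIntegral.integral_mono_on hxy (hbi x y)
      (intervalIntegrable_const (c := (1 : ℝ))) fun z _ => b.le_one
    rw [hdiff]
    simpa using this
  have hflat : ∀ x y, x ≤ y → (∀ z ∈ Set.Icc x y, c + δ ≤ |z|) → S y = S x := by
    intro x y hxy h
    rw [← sub_eq_zero, hdiff]
    refine (intervalIntegral.integral_congr (g := fun _ => (0 : ℝ)) fun z hz => ?_).trans (by simp)
    rw [Set.uIcc_of_le hxy] at hz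
    refine b.zero_of_le_dist ?_
    simpa [dist_eq_norm] using h z hz
  refine ⟨S, b, fun r => ?_, b.contDiff, fun r => ?_, fun r => ?_⟩
  · exact intervalIntegral.integral_hasDerivAt_right (hbi _ _)
      b.continuous.stronglyMeasurable.stronglyMeasurableAtFilter b.continuous.continuousAt
  · rw [abs_of_nonneg b.nonneg]
    exact b.le_one
  · have hSc : S c = c := hS_id c (abs_of_nonneg hc).le
    have hSnc : S (-c) = -c := hS_id (-c) (by rw [abs_neg, abs_of_nonneg hc])
    rcases le_total r (-c) with h1 | h1
    · rw [min_eq_left (by linarith), max_eq_left h1]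
      have hlow : -c - δ ≤ S r := by
        rcases le_total r (-c - δ) with h | h
        · rw [← hflat r (-c - δ) h fun z hz => by
            rw [abs_of_nonpos (by linarith [hz.2])]; linarith [hz.2]]
          linarith [hcontr (-c - δ) (-c) (by linarith)]
        · linarith [hcontr r (-c) h1]
      have := hmono h1
      rw [abs_le]
      constructor <;> linarith
    rcases le_total r c with h2 | h2
    · rw [min_eq_left h2, max_eq_right h1, hS_id r (abs_le.2 ⟨h1, h2⟩), sub_self, abs_zero]
      exact hδ.le
    · rw [min_eq_right h2, max_eq_right (by linarith)]
      have hup : S r ≤ c + δ := by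
        rcases le_total r (c + δ) with h | h
        · linarith [hcontr c r h2]
        · rw [hflat (c + δ) r h fun z hz => hz.1.trans (le_abs_self z)]
          linarith [hcontr c (c + δ) (by linarith)]
      have := hmono h2
      rw [abs_le]
      constructor <;> linarith

theorem abs_clip_le_level {c : ℝ} (hc : 0 ≤ c) (r : ℝ) : |max (-c) (min r c)| ≤ c :=
  abs_le.2 ⟨le_max_left _ _, max_le (by linarith) (min_le_right _ _)⟩

theorem abs_clip_le_abs {c : ℝ} (hc : 0 ≤ c) (r : ℝ) : |max (-c) (min r c)| ≤ |r| := by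
  refine abs_le.2 ⟨?_, max_le (by linarith [abs_nonneg r]) ((min_le_left _ _).trans (le_abs_self r))⟩
  rcases le_total r c with h | h
  · rw [min_eq_left h]
    exact (neg_abs_le r).trans (le_max_right _ _)
  · rw [min_eq_right h]
    exact (by linarith [abs_nonneg r] : -|r| ≤ c).trans (le_max_right _ _)

theorem abs_clip_sub_le_abs {c : ℝ} (hc : 0 ≤ c) (r : ℝ) : |max (-c) (min r c) - r| ≤ |r| := by
  rcases le_total r c with h | h
  · rw [min_eq_left h]
    rcases le_total r (-c) with h' | h'
    · rw [max_eq_left h', abs_of_nonneg (by linarith), abs_of_nonpos (by linarith)]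
      linarith
    · rw [max_eq_right h', sub_self, abs_zero]
      exact abs_nonneg r
  · rw [min_eq_right h, max_eq_right (by linarith), abs_of_nonpos (by linarith),
      abs_of_nonneg (by linarith)]
    linarith

/-- Truncation does not increase the total variation. -/
theorem planarTotalVariation_clip_le {U : Set (EuclideanSpace ℝ (Fin 2))} (hU : IsOpen U)
    (u : EuclideanSpace ℝ (Fin 2) → ℝ) {c : ℝ} (hc : 0 ≤ c) :
    planarTotalVariation U (fun y => max (-c) (min (u y) c)) ≤ planarTotalVariation U u := by
  by_cases hu : LocallyIntegrableOn u U volume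
  swap
  · rw [planarTotalVariation.eq_def U u, if_neg hu]
    exact le_top
  have hum : AEStronglyMeasurable u (volume.restrict U) := hu.aestronglyMeasurable
  have hcont : Continuous fun r : ℝ => max (-c) (min r c) := by fun_prop
  have hTm : AEStronglyMeasurable (fun y => max (-c) (min (u y) c)) (volume.restrict U) :=
    hcont.comp_aestronglyMeasurable hum
  have hT : LocallyIntegrableOn (fun y => max (-c) (min (u y) c)) U volume := by
    intro x hx
    obtain ⟨t, ht, htu⟩ := hu x hx
    -- The intersection with `U` is needed because measurability of the clip is known only there.
    exact ⟨t ∩ U, inter_mem ht self_mem_nhdsWithin,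
      Integrable.mono (htu.mono_set Set.inter_subset_left) (hTm.mono_set Set.inter_subset_right)
        (Eventually.of_forall fun y => abs_clip_le_abs hc (u y))⟩
  rw [planarTotalVariation.eq_def U (fun y => max (-c) (min (u y) c)), if_pos hT]
  refine iSup₂_le fun φ hφ => ?_
  have hDint := (continuous_planarDiv hφ.1).integrable_of_hasCompactSupport
    (hasCompactSupport_planarDiv hφ.2.1) (μ := volume)
  choose S s hS hs hs1 hSc using fun k : ℕ =>
    exists_smooth_approx_clip hc (Nat.one_div_pos_of_nat (α := ℝ) (n := k))
  have hSM : ∀ k r, |S k r| ≤ c + 1 := by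
    intro k r
    have h1 := hSc k r
    have h2 := abs_clip_le_level hc r
    have h3 : (1 : ℝ) / (k + 1) ≤ 1 :=
      div_le_one_of_le₀ (by linarith [Nat.cast_nonneg (α := ℝ) k]) (by positivity)
    have h4 := abs_sub_abs_le_abs_sub (S k r) (max (-c) (min r c))
    linarith
  have hlim : ∀ r, Tendsto (fun k => S k r) atTop (𝓝 (max (-c) (min r c))) := fun r =>
    tendsto_iff_norm_sub_tendsto_zero.2 <|
      squeeze_zero (fun _ => norm_nonneg _) (fun k => hSc k r) tendsto_one_div_add_atTop_nhds_zero_nat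
  have hconv : Tendsto (fun k => ∫ y in U, S k (u y) * planarDiv φ y) atTop
      (𝓝 (∫ y in U, max (-c) (min (u y) c) * planarDiv φ y)) := by
    refine tendsto_integral_of_dominated_convergence (fun y => (c + 1) * ‖planarDiv φ y‖)
      (fun k => ?_) (hDint.norm.const_mul (c + 1)).integrableOn
      (fun k => Eventually.of_forall fun y => ?_)
      (Eventually.of_forall fun y => (hlim (u y)).mul_const _)
    · have hScont : Continuous (S k) :=
        continuous_iff_continuousAt.2 fun r => (hS k r).continuousAt
      exact (hScont.comp_aestronglyMeasurable hum).mul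
        (continuous_planarDiv hφ.1).aestronglyMeasurable
    · rw [norm_mul]
      exact mul_le_mul_of_nonneg_right (hSM k _) (norm_nonneg _)
  exact le_of_tendsto' (ENNReal.tendsto_ofReal hconv) fun k =>
    ofReal_integral_comp_mul_planarDiv_le hU hu (hS k) (hs k) (hs1 k) (hSM k) hφ

/-! ### Slices, `Lᵖ` convergence and the main theorem -/

theorem continuous_slicePoint (t : ℝ) : Continuous (slicePoint t) := by
  unfold slicePoint
  refine (PiLp.continuous_toLp 2 _).comp (continuous_pi fun i => ?_)
  fin_cases i <;> simp <;> fun_prop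

theorem curlDensity_truncLevel_le {Ω : Set (EuclideanSpace ℝ (Fin 3))} (hΩ : IsOpen Ω)
    (f : EuclideanSpace ℝ (Fin 3) → ℝ) (n : ℕ) (t : ℝ) :
    curlDensity Ω (truncLevel n f) t ≤ curlDensity Ω f t :=
  planarTotalVariation_clip_le (hΩ.preimage (continuous_slicePoint t)) _ n.cast_nonneg

theorem eventually_truncLevel_eq (f : EuclideanSpace ℝ (Fin 3) → ℝ)
    (x : EuclideanSpace ℝ (Fin 3)) : ∀ᶠ n : ℕ in atTop, truncLevel n f x = f x := by
  filter_upwards [tendsto_natCast_atTop_atTop.eventually_ge_atTop |f x|] with n hn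
  obtain ⟨h1, h2⟩ := abs_le.1 hn
  simp only [truncLevel]
  rw [min_eq_left h2, max_eq_right h1]

/-- Dominated convergence in `Lᵖ` for finite exponents. -/
theorem tendsto_eLpNorm_zero_of_dominated {α : Type*} [MeasurableSpace α] {μ : Measure α}
    {p : ℝ≥0∞} (hp0 : p ≠ 0) (hp_top : p ≠ ∞) {F : ℕ → α → ℝ} {G : α → ℝ}
    (hF : ∀ n, AEStronglyMeasurable (F n) μ) (hG : MemLp G p μ)
    (hFG : ∀ n, ∀ᵐ x ∂μ, ‖F n x‖ ≤ ‖G x‖)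
    (hlim : ∀ᵐ x ∂μ, Tendsto (fun n => F n x) atTop (𝓝 0)) :
    Tendsto (fun n => eLpNorm (F n) p μ) atTop (𝓝 0) := by
  have hp : 0 < p.toReal := ENNReal.toReal_pos hp0 hp_top
  simp only [eLpNorm_eq_lintegral_rpow_enorm_toReal hp0 hp_top]
  have h : Tendsto (fun n => ∫⁻ x, ‖F n x‖ₑ ^ p.toReal ∂μ) atTop (𝓝 (∫⁻ _, 0 ∂μ)) := by
    refine tendsto_lintegral_of_dominated_convergence' (fun x => ‖G x‖ₑ ^ p.toReal)
      (fun n => (hF n).enorm.pow_const _) (fun n => ?_)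
      (lintegral_rpow_enorm_lt_top_of_eLpNorm_lt_top hp0 hp_top hG.2).ne ?_
    · filter_upwards [hFG n] with x hx
      exact ENNReal.rpow_le_rpow (enorm_le_iff_norm_le.2 hx) hp.le
    · filter_upwards [hlim] with x hx
      have := (ENNReal.continuous_rpow_const (y := p.toReal)).tendsto 0 |>.comp
        (by simpa using hx.enorm)
      simpa [Function.comp_def, ENNReal.zero_rpow_of_pos hp] using this
  have := (ENNReal.continuous_rpow_const (y := 1 / p.toReal)).tendsto _ |>.comp h
  simpa [Function.comp_def, ENNReal.zero_rpow_of_pos (one_div_pos.2 hp), hp] using this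

theorem aestronglyMeasurable_restrict_of_eq_zero_diff {α : Type*} [MeasurableSpace α]
    {μ : Measure α} {s t : Set α} (hs : MeasurableSet s) (ht : MeasurableSet t)
    {h : α → ℝ} (hh : AEStronglyMeasurable h (μ.restrict s)) (h0 : ∀ x ∈ t \ s, h x = 0) :
    AEStronglyMeasurable h (μ.restrict t) := by
  have h1 : AEStronglyMeasurable (s.indicator h) (μ.restrict t) :=
    ((aestronglyMeasurable_indicator_iff hs).2 hh).restrict
  refine h1.congr ?_
  filter_upwards [ae_restrict_mem ht] with x hx
  by_cases hxs : x ∈ s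
  · rw [Set.indicator_of_mem hxs]
  · rw [Set.indicator_of_notMem hxs, h0 x ⟨hx, hxs⟩]

theorem memLp_restrict_of_eq_zero_diff {α : Type*} [MeasurableSpace α]
    {μ : Measure α} {s t : Set α} (hs : MeasurableSet s) (ht : MeasurableSet t)
    {p : ℝ≥0∞} {h : α → ℝ} (hh : MemLp h p (μ.restrict s)) (h0 : ∀ x ∈ t \ s, h x = 0) :
    MemLp h p (μ.restrict t) := by
  have h1 : MemLp (s.indicator h) p (μ.restrict t) :=
    ((memLp_indicator_iff_restrict hs).2 hh).restrict t
  refine h1.ae_eq ?_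
  filter_upwards [ae_restrict_mem ht] with x hx
  by_cases hxs : x ∈ s
  · rw [Set.indicator_of_mem hxs]
  · rw [Set.indicator_of_notMem hxs, h0 x ⟨hx, hxs⟩]

theorem mainTheorem6 (Ω Ω₁ : Set (EuclideanSpace ℝ (Fin 3)))
    (hΩ : IsOpen Ω) (hΩ₁ : IsOpen Ω₁) (hsub : Ω₁ ⊆ Ω)
    (p : ℝ≥0∞) (hp_one : 1 ≤ p) (hp_top : p ≠ ∞)
    (f g : EuclideanSpace ℝ (Fin 3) → ℝ)
    (hf : AEStronglyMeasurable f (volume.restrict Ω₁))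
    (hgf : MemLp (fun x => g x * f x) p (volume.restrict Ω₁))
    (hf_zero : ∀ x ∈ Ω \ Ω₁, f x = 0)
    (hcurl : curlNorm Ω f < ∞) :
    (∀ n : ℕ, MemLp (truncLevel n f) ∞ (volume.restrict Ω) ∧ ∀ x, |truncLevel n f x| ≤ n) ∧
    (∀ n : ℕ, ∀ x ∈ Ω \ Ω₁, truncLevel n f x = 0) ∧
    MemLp (fun x => g x * f x) p (volume.restrict Ω) ∧
    (∀ n : ℕ, MemLp (fun x => g x * truncLevel n f x) p (volume.restrict Ω)) ∧
    Tendsto (fun n : ℕ =>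
      eLpNorm (fun x => g x * truncLevel n f x - g x * f x) p (volume.restrict Ω))
      atTop (𝓝 0) ∧
    (∀ (n : ℕ) (t : ℝ), curlDensity Ω (truncLevel n f) t ≤ curlDensity Ω f t) ∧
    (∀ n : ℕ, curlNorm Ω (truncLevel n f) ≤ curlNorm Ω f) := by
  have hfΩ : AEStronglyMeasurable f (volume.restrict Ω) :=
    aestronglyMeasurable_restrict_of_eq_zero_diff hΩ₁.measurableSet hΩ.measurableSet hf hf_zero
  have hgfΩ : MemLp (fun x => g x * f x) p (volume.restrict Ω) :=
    memLp_restrict_of_eq_zero_diff hΩ₁.measurableSet hΩ.measurableSet hgf fun x hx => by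
      rw [hf_zero x hx, mul_zero]
  have htm : ∀ n : ℕ, AEStronglyMeasurable (truncLevel n f) (volume.restrict Ω) := fun n =>
    (by fun_prop : Continuous fun r : ℝ => max (-(n : ℝ)) (min r n)).comp_aestronglyMeasurable hfΩ
  have hzero : ∀ (n : ℕ) (x : EuclideanSpace ℝ (Fin 3)), f x = 0 → truncLevel n f x = 0 :=
    fun n x hx => by simp [truncLevel, hx]
  have hgt : ∀ n : ℕ, AEStronglyMeasurable (fun x => g x * truncLevel n f x)
      (volume.restrict Ω) := fun n => by
    -- Since `g` is not assumed measurable, the product is written as `(g f) · (fⁿ / f)`; where `f =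
    -- 0` both sides vanish, as division by zero gives 0.
    refine (hgfΩ.1.aemeasurable.mul
      ((htm n).aemeasurable.div hfΩ.aemeasurable)).aestronglyMeasurable.congr
      (Eventually.of_forall fun x => ?_)
    simp only [Pi.mul_apply, Pi.div_apply]
    by_cases hx : f x = 0
    · simp [hx, hzero n x hx]
    · field_simp
  have hcd := fun n t => curlDensity_truncLevel_le hΩ f n t
  refine ⟨fun n => ⟨?_, fun x => abs_clip_le_level n.cast_nonneg _⟩,
    fun n x hx => hzero n x (hf_zero x hx), hgfΩ, fun n => ?_, ?_, hcd,
    fun n => lintegral_mono fun t => hcd n t⟩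
  · exact memLp_top_of_bound (htm n) n
      (Eventually.of_forall fun x => abs_clip_le_level n.cast_nonneg _)
  · refine hgfΩ.mono (hgt n) (Eventually.of_forall fun x => ?_)
    rw [norm_mul, norm_mul]
    exact mul_le_mul_of_nonneg_left (abs_clip_le_abs n.cast_nonneg _) (norm_nonneg _)
  · refine tendsto_eLpNorm_zero_of_dominated (zero_lt_one.trans_le hp_one).ne' hp_top
      (fun n => (hgt n).sub hgfΩ.1) hgfΩ (fun n => Eventually.of_forall fun x => ?_)
      (Eventually.of_forall fun x => ?_)
    · rw [← mul_sub, norm_mul, norm_mul]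
      exact mul_le_mul_of_nonneg_left (abs_clip_sub_le_abs n.cast_nonneg _) (norm_nonneg _)
    · refine tendsto_const_nhds.congr' ?_
      filter_upwards [eventually_truncLevel_eq f x] with n hn
      rw [hn, sub_self]
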